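/- Let $k$ be a finite field with $q$ elements, of characteristic $p \ge 5$, let $C/k$ be a proper, smooth, geometrically connected curve and let $K$ be its function field (equivalently, $K$ is a finite extension of $k(t)$ for some $t\in K$ transcendental over $k$, and $k$ is algebraically closed in $K$). Let $E/K$ be an elliptic curve with nonconstant $j$-invariant, that is, $j(E) \notin k$. For $f \in K^\times$ let $E_f/K$ be the quadratic twist of $E$ by $f$: if $E$ is given by $y^2 = x^3 + ax + b$, then $E_f$ is given by $y^2 = x^3 + f^2 a x + f^3 b$. The places $v$ of $K$ are the closed points of $C$; equivalently, they are the discrete valuation rings containing $k$ with fraction field $K$. Let $k_v$ be the residue field of $v$ and $d_v = [k_v : k]$. For an elliptic curve $E'/K$ and a place $v$ of $K$, put $$ L_v(T^{d_v},E'/K) = \begin{cases} 1 - a_v T^{d_v} + q^{d_v} T^{2 d_v} & \text{if } E' \text{ has good reduction } E'_v \text{ at } v, \text{ where } a_v = 1 + q^{d_v} - \# E'_v(k_v),\\ 1 - T^{d_v} & \text{if } E' \text{ has split multiplicative reduction at } v,\\ 1 + T^{d_v} & \text{if } E' \text{ has nonsplit multiplicative reduction at } v,\\ 1 & \text{if }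 E' \text{ has additive reduction at } v, \end{cases} $$ and $L(T,E'/K) = \prod_v L_v(T^{d_v},E'/K)^{-1} \in 1 + T\,\mathbb{Z}[[T]]$, the product being over all places $v$ of $K$. Let $f_1, f_2 \in K^\times$, and let $U_{f_1,f_2}$ be the set of places $v$ of $K$ such that $E_{f_1}$ and $E_{f_2}$ both have good reduction at $v$, or both have multiplicative (split or nonsplit) reduction at $v$, or both have additive reduction at $v$. Then, for every $f \in K^\times$, the Euler product $L(T,E_f/K)$ converges coefficientwise in $\mathbb{Z}[[T]]$, all its factors have constant term $1$, and so does its value; only finitely many places lie outside $U_{f_1,f_2}$; and in $(\mathbb{Z}/2\mathbb{Z})[[T]]$ $$ \frac{L(T,E_{f_1}/K)}{L(T,E_{f_2}/K)} \equiv \prod_{v \notin U_{f_1,f_2}} \frac{L_v(T^{d_v},E_{f_2}/K)}{L_v(T^{d_v},E_{f_1}/K)} \pmod 2 . $$ No hypothesis is made on the $2$-torsion of $E(K)$. -/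

import Mathlib

open scoped Polynomial PowerSeries IntermediateField PowerSeries.WithPiTopology

/-- `K` is the function field of a proper, smooth, geometrically connected curve over the perfect
field `k`: it is a finite extension of `k(t)` for some `t` transcendental over `k`, and `k` is
algebraically closed in `K`. -/
structure IsCurveFunctionField (k K : Type*) [Field k] [Field K] [Algebra k K] : Prop where
  exists_finite : ∃ t : K, Transcendental k t ∧ FiniteDimensional k⟮t⟯ K
  mem_range_of_isAlgebraic : ∀ x : K, IsAlgebraic k x → x ∈ (algebraMap k K).range

/-- A place of `K / k` (equivalently, a closed point of the corresponding curve): a discrete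
valuation ring with fraction field `K` that contains `k`. -/
structure Place (k K : Type*) [Field k] [Field K] [Algebra k K] where
  /-- The valuation ring `𝒪_v` in `K`. -/
  ring : ValuationSubring K
  isDVR : IsDiscreteValuationRing ring
  algebraMap_mem : ∀ c : k, algebraMap k K c ∈ ring

attribute [instance] Place.isDVR

noncomputable section

namespace Place

variable {k K : Type*} [Field k] [Field K] [Algebra k K]

/-- The embedding of the constants `k` in the residue field `k_v`. -/
def constHom (v : Place k K) : k →+* IsLocalRing.ResidueField v.ring :=
  (IsLocalRing.residue v.ring).comp
    ((algebraMap k K).codRestrict v.ring.toSubring v.algebraMap_mem)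

/-- The degree `d_v = [k_v : k]`. -/
def degree (v : Place k K) : ℕ :=
  letI : Algebra k (IsLocalRing.ResidueField v.ring) := v.constHom.toAlgebra
  Module.finrank k (IsLocalRing.ResidueField v.ring)

end Place

namespace WeierstrassCurve

/-- The quadratic twist of `y² = x³ + (b₂/4) x² + (b₄/2) x + b₆/4` (the equation of `W` after
completing the square) by `f`. If `W` is `y² = x³ + a x + b`, this is
`y² = x³ + f² a x + f³ b`. -/
def quadraticTwist {K : Type*} [Field K] (W : WeierstrassCurve K) (f : Kˣ) :
    WeierstrassCurve K where
  a₁ := 0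
  a₂ := f * (W.b₂ / 4)
  a₃ := 0
  a₄ := f ^ 2 * (W.b₄ / 2)
  a₆ := f ^ 3 * (W.b₆ / 4)

variable (k : Type*) {K : Type*} [Field k] [Field K] [Algebra k K]

/-- The places of good reduction, read off from a minimal Weierstrass equation at the place. -/
def goodPlaces (W : WeierstrassCurve K) : Set (Place k K) :=
  {v | (W.minimal v.ring).HasGoodReduction v.ring}

/-- The places of multiplicative (split or nonsplit) reduction. -/
def multiplicativePlaces (W : WeierstrassCurve K) : Set (Place k K) :=
  {v | (W.minimal v.ring).HasMultiplicativeReduction v.ring}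

/-- The places of additive reduction. -/
def additivePlaces (W : WeierstrassCurve K) : Set (Place k K) :=
  {v | (W.minimal v.ring).HasAdditiveReduction v.ring}

variable {k}

/-- `L_v(T^{d_v}, W/K)`: the local polynomial `1 - a_v T + q^{d_v} T²` (good reduction), `1 - T`
(split multiplicative), `1 + T` (nonsplit multiplicative) or `1` (additive), evaluated at
`T^{d_v}`. -/
def eulerFactor (W : WeierstrassCurve K) (v : Place k K) : ℤ⟦X⟧ :=
  ((Polynomial.expand ℤ v.degree (W.localPolynomial v.ring) : ℤ[X]) : ℤ⟦X⟧)

variable (k)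

/-- `L(T, W/K) = ∏_v L_v(T^{d_v}, W/K)⁻¹`, an infinite product over all places of `K / k`
in the topology of coefficientwise convergence of `ℤ⟦T⟧`. -/
def LSeriesOverCurve (W : WeierstrassCurve K) : ℤ⟦X⟧ :=
  ∏' v : Place k K, (W.eulerFactor v).invOfUnit 1

/-- `U_{f₁,f₂}`: the places at which the twists of `W` by `f₁` and by `f₂` both have good
reduction, both multiplicative reduction, or both additive reduction. -/
def sameReductionPlaces (W : WeierstrassCurve K) (f₁ f₂ : Kˣ) : Set (Place k K) :=
  ((W.quadraticTwist f₁).goodPlaces k ∩ (W.quadraticTwist f₂).goodPlaces k) ∪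
  ((W.quadraticTwist f₁).multiplicativePlaces k ∩ (W.quadraticTwist f₂).multiplicativePlaces k) ∪
  ((W.quadraticTwist f₁).additivePlaces k ∩ (W.quadraticTwist f₂).additivePlaces k)

end WeierstrassCurve

end

/-! Modulo 2 the two Euler products agree factor by factor on `sameReductionPlaces`. The factors `1
- T` and `1 + T` coincide, additive factors are `1`, and at a good place only the parity of the
point count matters. Negation is an involution on the points of the reduction, so that parity is one
plus the number of roots of the 2-torsion cubic in `k_v` (`natCard_point_modEq`). Twisting changes
this cubic by a substitution `x ↦ w * x + r`, up to a nonzero factor. When both minimal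
discriminants are units, `w` is a unit and `r` is integral (`IsTwist.exists_isUnit_of_baseChange`),
so the substitution reduces to a bijection between the roots over `k_v`.

The rest is finiteness: a nonzero function has finitely many zeros and poles, and only finitely many
places have a given degree. The first bounds the exceptional set, the second makes the products
converge. Both follow from linear independence over `k⟮x⟯`, with `[K : k⟮x⟯]` finite. -/

/-! ### Function fields of one variable -/

section FunctionField

open IntermediateField
open scoped IntermediateField.algebraAdjoinAdjoin

variable {k K : Type*} [Field k] [Field K] [Algebra k K]

/-- Exchange: `x` is algebraic over `k⟮t⟯` and transcendental over `k`, so `t` is algebraic over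
`k⟮x⟯`. Then `K` is finite over `k⟮t⟯⟮x⟯ = k⟮x⟯⟮t⟯`, which is finite over `k⟮x⟯`. -/
theorem IsCurveFunctionField.finiteDimensional_adjoin (hK : IsCurveFunctionField k K) {x : K}
    (hx : Transcendental k x) : FiniteDimensional k⟮x⟯ K := by
  obtain ⟨t, ht, hfin⟩ := hK.exists_finite
  have hxt : IsAlgebraic k⟮x⟯ t :=
    isAlgebraic_adjoin_iff.mpr (.adjoin_singleton ht hx
      (isAlgebraic_adjoin_iff.mp (Algebra.IsAlgebraic.isAlgebraic x)))
  let Fxt := restrictScalars k k⟮x⟯⟮t⟯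
  let Ftx := restrictScalars k k⟮t⟯⟮x⟯
  let : Algebra k⟮x⟯ Fxt := k⟮x⟯⟮t⟯.algebra
  let : Module k⟮x⟯ Fxt := Algebra.toModule
  let : SMul k⟮x⟯ Fxt := Algebra.toSMul
  let : Algebra k⟮t⟯ Ftx := k⟮t⟯⟮x⟯.algebra
  let : Module k⟮t⟯ Ftx := Algebra.toModule
  let : SMul k⟮t⟯ Ftx := Algebra.toSMul
  have : FiniteDimensional k⟮x⟯ Fxt :=
    adjoin.finiteDimensional (isAlgebraic_iff_isIntegral.mp hxt)
  have : FiniteDimensional Fxt K := by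
    unfold Fxt
    rw [adjoin_simple_comm]
    have : IsScalarTower k⟮t⟯ Ftx K := isScalarTower_mid' k⟮t⟯⟮x⟯
    exact .right k⟮t⟯ Ftx K
  have : IsScalarTower k⟮x⟯ Fxt K := isScalarTower_mid' k⟮x⟯⟮t⟯
  exact .trans k⟮x⟯ Fxt K

/-- Descent: after clearing denominators, a relation has polynomial coefficients in `x`. The
hypothesis lets one divide it by `x` again and again, so each coefficient is divisible by every
power of `X`. In the applications the hypothesis is checked by reducing at zeros of `x`. -/
theorem linearIndependent_adjoin_of_coeff_zero {x : K} (hx : Transcendental k x) {ι : Type*}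
    (y : ι → K)
    (H : ∀ (s : Finset ι) (p : ι → k[X]), ∑ i ∈ s, Polynomial.aeval x (p i) * y i = 0 →
      ∀ i ∈ s, (p i).coeff 0 = 0) :
    LinearIndependent k⟮x⟯ y := by
  have hx0 : x ≠ 0 := fun h ↦ hx (h ▸ isAlgebraic_zero)
  have key : ∀ (n : ℕ) (s : Finset ι) (p : ι → k[X]),
      ∑ i ∈ s, Polynomial.aeval x (p i) * y i = 0 → ∀ i ∈ s, Polynomial.X ^ n ∣ p i := by
    intro n
    induction n with
    | zero => intro s p _ i _; simp
    | succ n ih =>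
      intro s p hp i hi
      have h0 : ∀ j ∈ s, p j = Polynomial.X * (p j).divX := fun j hj ↦ by
        conv_lhs => rw [← Polynomial.divX_mul_X_add (p j), H s p hp j hj]
        simp [mul_comm]
      have h1 : ∑ j ∈ s, Polynomial.aeval x ((p j).divX) * y j = 0 := by
        have : x * ∑ j ∈ s, Polynomial.aeval x ((p j).divX) * y j = 0 := by
          rw [← hp, Finset.mul_sum]
          refine Finset.sum_congr rfl fun j hj ↦ ?_
          conv_rhs => rw [h0 j hj]
          simp [mul_assoc]
        exact (mul_eq_zero.mp this).resolve_left hx0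
      rw [h0 i hi, pow_succ']
      exact mul_dvd_mul_left _ (ih s _ h1 i hi)
  have hA : LinearIndependent (Algebra.adjoin k {x}) y := by
    rw [linearIndependent_iff']
    intro s g hg i hi
    have hex : ∀ j, ∃ p : k[X], Polynomial.aeval x p = (g j : K) := fun j ↦ by
      have h := (Algebra.adjoin_singleton_eq_range_aeval k x).le (g j).2
      exact h
    choose p hp using hex
    have hsum : ∑ j ∈ s, Polynomial.aeval x (p j) * y j = 0 := by
      rw [← hg]
      exact Finset.sum_congr rfl fun j _ ↦ by rw [hp, Subalgebra.smul_def, smul_eq_mul]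
    have hpi : p i = 0 := by
      by_contra hne
      have := Polynomial.natDegree_le_of_dvd (key ((p i).natDegree + 1) s p hsum i hi) hne
      simp at this
    ext
    rw [← hp, hpi, map_zero, ZeroMemClass.coe_zero]
  exact (LinearIndependent.iff_fractionRing (Algebra.adjoin k {x}) k⟮x⟯).mp hA

end FunctionField

/-! ### Places: approximation, finiteness of zeros and poles, residue fields -/

namespace Place

variable {k K : Type*} [Field k] [Field K] [Algebra k K]

theorem ext_ring {v w : Place k K} (h : v.ring = w.ring) : v = w := by
  cases v; cases w; cases h; rfl

theorem valuation_algebraMap (v : Place k K) {c : k} (hc : c ≠ 0) :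
    v.ring.valuation (algebraMap k K c) = 1 := by
  refine le_antisymm ((v.ring.valuation_le_one_iff _).mpr (v.algebraMap_mem c)) ?_
  have h := (v.ring.valuation_le_one_iff _).mpr (v.algebraMap_mem c⁻¹)
  rw [map_inv₀, map_inv₀] at h
  exact (inv_le_one₀ (by simpa [zero_lt_iff] using hc)).mp h

theorem valuation_algebraMap_le (v : Place k K) (c : k) :
    v.ring.valuation (algebraMap k K c) ≤ 1 :=
  (v.ring.valuation_le_one_iff _).mpr (v.algebraMap_mem c)

theorem valuation_aeval_sub_lt_one (v : Place k K) {x : K} (hx : v.ring.valuation x < 1)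
    (p : k[X]) :
    v.ring.valuation (Polynomial.aeval x p - algebraMap k K (p.coeff 0)) < 1 := by
  have hmem : ∀ q : k[X], v.ring.valuation (Polynomial.aeval x q) ≤ 1 := fun q ↦ by
    rw [Polynomial.aeval_eq_sum_range]
    refine Valuation.map_sum_le _ fun i _ ↦ ?_
    rw [Algebra.smul_def, map_mul, map_pow]
    exact mul_le_one' (v.valuation_algebraMap_le _) (pow_le_one' hx.le _)
  conv_lhs => rw [← Polynomial.divX_mul_X_add p]
  simp only [map_add, map_mul, Polynomial.aeval_X, Polynomial.aeval_C, Polynomial.coeff_add,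
    Polynomial.mul_coeff_zero, Polynomial.coeff_X_zero, mul_zero, Polynomial.coeff_C_zero, zero_add,
    add_sub_cancel_right]
  exact (mul_le_of_le_one_left' (hmem _)).trans_lt hx

theorem valuation_aeval_eq_one (v : Place k K) {x : K} (hx : v.ring.valuation x < 1)
    {p : k[X]} (hp : p.coeff 0 ≠ 0) : v.ring.valuation (Polynomial.aeval x p) = 1 := by
  have h := v.valuation_aeval_sub_lt_one hx p
  rw [← v.valuation_algebraMap hp] at h ⊢
  exact Valuation.map_eq_of_sub_lt _ h

theorem valuation_aeval_le_one (v : Place k K) {x : K} (hx : v.ring.valuation x < 1)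
    (p : k[X]) : v.ring.valuation (Polynomial.aeval x p) ≤ 1 := by
  rw [← sub_add_cancel (Polynomial.aeval x p) (algebraMap k K (p.coeff 0))]
  exact (Valuation.map_add _ _ _).trans
    (max_le (v.valuation_aeval_sub_lt_one hx p).le (v.valuation_algebraMap_le _))

theorem transcendental_of_valuation_lt_one (hK : IsCurveFunctionField k K) (v : Place k K) {x : K}
    (hx0 : x ≠ 0) (hx : v.ring.valuation x < 1) : Transcendental k x := by
  intro halg
  obtain ⟨c, rfl⟩ := hK.mem_range_of_isAlgebraic x halg
  exact hx.ne (v.valuation_algebraMap fun h ↦ hx0 (by simp [h]))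

theorem exists_valuation_lt_one (v : Place k K) : ∃ x : K, x ≠ 0 ∧ v.ring.valuation x < 1 := by
  obtain ⟨ϖ, hϖ⟩ := IsDiscreteValuationRing.exists_irreducible v.ring
  exact ⟨ϖ, fun h ↦ hϖ.ne_zero (by ext; exact h),
    (v.ring.valuation_lt_one_iff ϖ).mp ((IsLocalRing.mem_maximalIdeal _).mpr hϖ.not_isUnit)⟩

/-- A real absolute value whose unit ball is the valuation ring. -/
theorem exists_absoluteValue (v : Place k K) :
    ∃ a : AbsoluteValue K ℝ, ∀ x, a x ≤ 1 ↔ x ∈ v.ring := by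
  have hb : (1 : NNReal) < 2 := one_lt_two
  refine ⟨(IsDiscreteValuationRing.maximalIdeal v.ring).adicAbv hb, fun x ↦ ⟨fun h ↦ ?_, fun h ↦ ?_⟩⟩
  · by_contra hx
    have hx' : x⁻¹ ∈ v.ring := (v.ring.mem_or_inv_mem x).resolve_left hx
    have hm : (⟨x⁻¹, hx'⟩ : v.ring) ∈ IsLocalRing.maximalIdeal v.ring := by
      rw [v.ring.valuation_lt_one_iff, map_inv₀]
      refine inv_lt_one_of_one_lt₀ (lt_of_not_ge fun h ↦ hx ?_)
      exact (v.ring.valuation_le_one_iff _).mp h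
    have := (IsDiscreteValuationRing.maximalIdeal v.ring).adicAbv_coe_lt_one_iff (K := K) hb _
      |>.mpr hm
    rw [show algebraMap v.ring K ⟨x⁻¹, hx'⟩ = x⁻¹ from rfl, map_inv₀] at this
    have hx0 : x ≠ 0 := by rintro rfl; exact hx v.ring.zero_mem
    rw [inv_lt_one₀ (AbsoluteValue.pos _ hx0)] at this
    exact this.not_ge h
  · exact (IsDiscreteValuationRing.maximalIdeal v.ring).adicAbv_coe_le_one (K := K) hb ⟨x, h⟩

theorem eq_of_ring_le {v w : Place k K} (h : v.ring ≤ w.ring) : v = w := by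
  refine ext_ring (v.ring.eq_of_le_of_ne_top h fun htop ↦ ?_)
  obtain ⟨x, hx0, hx⟩ := w.exists_valuation_lt_one
  have : x⁻¹ ∈ w.ring := htop ▸ ValuationSubring.mem_top _
  rw [← ValuationSubring.valuation_le_one_iff, map_inv₀] at this
  exact this.not_gt ((one_lt_inv₀ (by simpa [zero_lt_iff] using hx0)).mpr hx)

/-- Weak approximation provides `z` large at `v` and small at the other places of `s`; then `(1 +
z⁻¹)⁻¹` is a unit at `v` and still small elsewhere. -/
theorem exists_valuation_eq_one_and_lt_one (s : Finset (Place k K)) (v : s) :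
    ∃ y : K, v.1.ring.valuation y = 1 ∧ ∀ w : s, w ≠ v → w.1.ring.valuation y < 1 := by
  choose a ha using fun v : Place k K ↦ v.exists_absoluteValue
  have hnt : ∀ w : s, (a w).IsNontrivial := fun w ↦ by
    obtain ⟨x, hx0, hx⟩ := w.1.exists_valuation_lt_one
    refine ⟨x, hx0, fun h1 ↦ ?_⟩
    have : x⁻¹ ∈ w.1.ring := (ha w _).mp (by rw [map_inv₀, h1, inv_one])
    rw [← ValuationSubring.valuation_le_one_iff, map_inv₀] at this
    exact this.not_gt ((one_lt_inv₀ (by simpa [zero_lt_iff] using hx0)).mpr hx)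
  have hne : Pairwise fun w u : s ↦ ¬ (a w).IsEquiv (a u) := fun w u hwu h ↦ by
    refine hwu (Subtype.ext (eq_of_ring_le fun x hx ↦ ?_))
    rw [← ha] at hx ⊢
    simpa using (h x 1).mp (by simpa using hx)
  obtain ⟨z, hz, hz'⟩ := AbsoluteValue.exists_one_lt_lt_one_pi_of_not_isEquiv hnt hne v
  have val_lt : ∀ (w : s) (x : K), 1 < a w x → w.1.ring.valuation x⁻¹ < 1 := fun w x h ↦ by
    rw [map_inv₀]
    refine inv_lt_one_of_one_lt₀ (lt_of_not_ge fun h' ↦ h.not_ge ?_)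
    exact (ha w _).mpr ((ValuationSubring.valuation_le_one_iff _ _).mp h')
  refine ⟨(1 + z⁻¹)⁻¹, ?_, fun w hw ↦ ?_⟩
  · rw [map_inv₀, Valuation.map_one_add_of_lt _ (val_lt v z hz), inv_one]
  · have hz0 : z ≠ 0 := by rintro rfl; simp at hz; linarith
    have h1 : 1 < w.1.ring.valuation z⁻¹ := by
      refine lt_of_not_ge fun h' ↦ ?_
      have := (ha w _).mpr ((ValuationSubring.valuation_le_one_iff _ _).mp h')
      rw [map_inv₀, inv_le_one₀ (AbsoluteValue.pos _ hz0)] at this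
      exact this.not_gt (hz' w hw)
    rw [map_inv₀, Valuation.map_add_eq_of_lt_right _ (by rwa [map_one])]
    exact inv_lt_one_of_one_lt₀ h1

/-- There are at most `[K : k⟮x⟯]` zeros of `x`: approximating elements, one for each zero, are
independent over `k⟮x⟯`. In a relation whose coefficient at `v` has nonzero constant term, the
`v`-term is a `v`-unit while all others lie in the maximal ideal. -/
theorem finite_setOf_valuation_lt_one (hK : IsCurveFunctionField k K) {x : K} (hx0 : x ≠ 0) :
    {v : Place k K | v.ring.valuation x < 1}.Finite := by
  classical
  by_contra hinf
  obtain ⟨v₀, hv₀⟩ := Set.Infinite.nonempty hinf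
  have hx := v₀.transcendental_of_valuation_lt_one hK hx0 hv₀
  have := hK.finiteDimensional_adjoin hx
  obtain ⟨s, hs, hcard⟩ :=
    Set.Infinite.exists_subset_card_eq hinf (Module.finrank k⟮x⟯ K + 1)
  choose y hy hy' using exists_valuation_eq_one_and_lt_one s
  have hli : LinearIndependent k⟮x⟯ y := by
    refine linearIndependent_adjoin_of_coeff_zero hx y fun t p hp v hv ↦ ?_
    by_contra hc
    have hvx : v.1.ring.valuation x < 1 := hs v.2
    rw [← Finset.add_sum_erase _ _ hv, add_eq_zero_iff_eq_neg] at hp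
    have h1 : v.1.ring.valuation (Polynomial.aeval x (p v) * y v) = 1 := by
      rw [map_mul, v.1.valuation_aeval_eq_one hvx hc, hy, one_mul]
    rw [hp, Valuation.map_neg] at h1
    refine h1.not_lt (Valuation.map_sum_lt _ one_ne_zero fun w hw ↦ ?_)
    rw [map_mul]
    exact (mul_le_of_le_one_left' (v.1.valuation_aeval_le_one hvx _)).trans_lt
      (hy' w v (Finset.ne_of_mem_erase hw).symm)
  have := hli.fintype_card_le_finrank
  rw [Fintype.card_coe, hcard] at this
  omega

theorem finite_setOf_valuation_ne_one (hK : IsCurveFunctionField k K) {x : K} (hx0 : x ≠ 0) :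
    {v : Place k K | v.ring.valuation x ≠ 1}.Finite := by
  refine ((finite_setOf_valuation_lt_one hK hx0).union
    (finite_setOf_valuation_lt_one hK (inv_ne_zero hx0))).subset fun v hv ↦ ?_
  rcases lt_or_gt_of_ne hv with h | h
  · exact .inl h
  · exact .inr (by simpa using inv_lt_one_of_one_lt₀ h)

/-- Lifts of a `k`-basis of the residue field are independent over `k⟮x⟯` for `x` in the maximal
ideal, because a relation reduces to one between the constant terms of its coefficients. -/
theorem finite_residueField (hK : IsCurveFunctionField k K) (v : Place k K) :
    letI : Algebra k (IsLocalRing.ResidueField v.ring) := v.constHom.toAlgebra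
    Module.Finite k (IsLocalRing.ResidueField v.ring) := by
  let : Algebra k (IsLocalRing.ResidueField v.ring) := v.constHom.toAlgebra
  obtain ⟨x, hx0, hvx⟩ := v.exists_valuation_lt_one
  have hx := v.transcendental_of_valuation_lt_one hK hx0 hvx
  have := hK.finiteDimensional_adjoin hx
  let b := Module.Basis.ofVectorSpace k (IsLocalRing.ResidueField v.ring)
  choose y hy using fun i ↦ IsLocalRing.residue_surjective (b i)
  have hli : LinearIndependent k⟮x⟯ fun i ↦ (y i : K) := by
    refine linearIndependent_adjoin_of_coeff_zero hx _ fun s p hp ↦ ?_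
    refine linearIndependent_iff'.mp b.linearIndependent s (fun i ↦ (p i).coeff 0) ?_
    have hmem : ∀ q : k[X], Polynomial.aeval x q ∈ v.ring := fun q ↦
      (v.ring.valuation_le_one_iff _).mp (v.valuation_aeval_le_one hvx q)
    have hres : ∀ q : k[X], IsLocalRing.residue v.ring ⟨_, hmem q⟩ = v.constHom (q.coeff 0) :=
      fun q ↦ by
        rw [constHom, RingHom.comp_apply, ← sub_eq_zero, ← map_sub, IsLocalRing.residue_eq_zero_iff,
          v.ring.valuation_lt_one_iff]
        exact v.valuation_aeval_sub_lt_one hvx q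
    have h0 : ∑ i ∈ s, (⟨_, hmem (p i)⟩ : v.ring) * y i = 0 := by
      ext
      push_cast
      exact hp
    have h1 := congrArg (IsLocalRing.residue v.ring) h0
    simp only [map_sum, map_mul, hres, hy, map_zero] at h1
    exact h1
  have := hli.finite
  exact Module.Finite.of_basis b

theorem degree_pos (hK : IsCurveFunctionField k K) (v : Place k K) : 0 < v.degree := by
  let : Algebra k (IsLocalRing.ResidueField v.ring) := v.constHom.toAlgebra
  have := v.finite_residueField hK
  exact Module.finrank_pos

theorem natCard_residueField (hK : IsCurveFunctionField k K) (v : Place k K) :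
    Nat.card (IsLocalRing.ResidueField v.ring) = Nat.card k ^ v.degree := by
  let : Algebra k (IsLocalRing.ResidueField v.ring) := v.constHom.toAlgebra
  have := v.finite_residueField hK
  exact Module.natCard_eq_pow_finrank

section FiniteConstants

variable [Finite k]

theorem finite_residueField_of_finite (hK : IsCurveFunctionField k K) (v : Place k K) :
    Finite (IsLocalRing.ResidueField v.ring) := by
  let : Algebra k (IsLocalRing.ResidueField v.ring) := v.constHom.toAlgebra
  have := v.finite_residueField hK
  exact Module.finite_of_finite k

/-- In a residue field with `N = q ^ d` elements every element satisfies `a ^ N = a`. Hence a place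
of degree `d` is a zero of `t ^ N - t` or a pole of `t`. -/
theorem finite_setOf_degree_eq (hK : IsCurveFunctionField k K) (d : ℕ) :
    {v : Place k K | v.degree = d}.Finite := by
  obtain ⟨t, ht, -⟩ := hK.exists_finite
  have ht0 : t ≠ 0 := fun h ↦ ht (h ▸ isAlgebraic_zero)
  rcases Nat.eq_zero_or_pos d with rfl | hd
  · exact Set.finite_empty.subset fun v hv ↦ ((v.degree_pos hK).ne' hv).elim
  set N := Nat.card k ^ d with hN
  have hN1 : 1 < N := Nat.one_lt_pow hd.ne' Finite.one_lt_card
  have hne : t ^ N - t ≠ 0 := by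
    intro h
    refine ht ⟨Polynomial.X ^ N - Polynomial.X, FiniteField.X_pow_card_sub_X_ne_zero k hN1, ?_⟩
    simpa using h
  refine ((finite_setOf_valuation_lt_one hK hne).union
    (finite_setOf_valuation_lt_one hK (inv_ne_zero ht0))).subset fun v hv ↦ ?_
  by_cases htv : t ∈ v.ring
  · left
    have hcard := v.natCard_residueField hK
    rw [show v.degree = d from hv] at hcard
    have := v.finite_residueField_of_finite hK
    have := Fintype.ofFinite (IsLocalRing.ResidueField v.ring)
    have h := FiniteField.pow_card (IsLocalRing.residue v.ring ⟨t, htv⟩)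
    rw [← Nat.card_eq_fintype_card, hcard, ← map_pow, ← sub_eq_zero, ← map_sub,
      IsLocalRing.residue_eq_zero_iff, v.ring.valuation_lt_one_iff] at h
    exact h
  · right
    rw [Set.mem_ofPred_eq, map_inv₀]
    exact inv_lt_one_of_one_lt₀ (lt_of_not_ge fun h ↦ htv ((v.ring.valuation_le_one_iff _).mp h))

theorem finite_setOf_degree_le (hK : IsCurveFunctionField k K) (d : ℕ) :
    {v : Place k K | v.degree ≤ d}.Finite := by
  refine ((Set.finite_Iic d).biUnion fun n _ ↦ finite_setOf_degree_eq hK n).subset fun v hv ↦ ?_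
  exact Set.mem_biUnion hv rfl

end FiniteConstants

end Place

/-! ### Infinite products of power series -/

namespace PowerSeries

theorem multipliable_one_add_of_finite_order_le {R ι : Type*} [CommSemiring R] [TopologicalSpace R]
    {f : ι → R⟦X⟧} (h : ∀ n : ℕ, {i | (f i).order ≤ n}.Finite) : Multipliable (1 + f ·) := by
  -- In the expansion over finite sets `s`, the product over `s` reaches degree `n` only if every
  -- member has order at most `n`; so finitely many `s` contribute to each coefficient.
  refine multipliable_one_add_of_summable_prod <|
    (WithPiTopology.summable_iff_summable_coeff _).mpr fun n ↦ summable_of_hasFiniteSupport ?_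
  refine ((h n).toFinset.powerset.finite_toSet).subset fun s hs ↦ ?_
  rw [Finset.mem_coe, Finset.mem_powerset]
  intro x hx
  by_contra hxn
  refine hs (coeff_of_lt_order _ ?_)
  have hlt : (n : ℕ∞) < (f x).order := by simpa using hxn
  refine hlt.trans_le (le_trans ?_ (le_order_prod _ _))
  exact Finset.single_le_sum (f := fun i ↦ (f i).order) (by simp) hx

theorem continuous_map_of_discrete {R S : Type*} [CommRing R] [CommRing S] [TopologicalSpace R]
    [TopologicalSpace S] [DiscreteTopology R] (φ : R →+* S) : Continuous (map φ) := by
  refine continuous_pi fun d ↦ ?_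
  exact (continuous_of_discreteTopology (f := φ)).comp (continuous_apply d)

theorem constantCoeff_tprod_eq_one {R ι : Type*} [CommRing R] [TopologicalSpace R] [T2Space R]
    {f : ι → R⟦X⟧} (hf : Multipliable f) (h : ∀ i, constantCoeff (f i) = 1) :
    constantCoeff (∏' i, f i) = 1 := by
  rw [hf.map_tprod constantCoeff (WithPiTopology.continuous_constantCoeff R)]
  simp [h]

/-- Passing to the quotient of two convergent products whose factors agree under `φ` outside a
finite set `S`. -/
theorem map_tprod_mul_invOfUnit {R S ι : Type*} [CommRing R] [CommRing S] [TopologicalSpace R]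
    [DiscreteTopology R] (φ : R →+* S) {e₁ e₂ : ι → R⟦X⟧}
    (h₁ : ∀ i, constantCoeff (e₁ i) = 1) (h₂ : ∀ i, constantCoeff (e₂ i) = 1)
    (m₁ : Multipliable fun i ↦ (e₁ i).invOfUnit 1) (m₂ : Multipliable fun i ↦ (e₂ i).invOfUnit 1)
    (hc₂ : constantCoeff (∏' i, (e₂ i).invOfUnit 1) = 1) {T : Set ι} (hT : T.Finite)
    (heq : ∀ i ∉ T, map φ (e₁ i) = map φ (e₂ i)) :
    map φ ((∏' i, (e₁ i).invOfUnit 1) * (∏' i, (e₂ i).invOfUnit 1).invOfUnit 1) =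
      map φ (∏ᶠ i ∈ T, e₂ i * (e₁ i).invOfUnit 1) := by
  classical
  let : TopologicalSpace S := ⊥
  have : DiscreteTopology S := ⟨rfl⟩
  have i₁ : ∀ i, map φ (e₁ i) * map φ ((e₁ i).invOfUnit 1) = 1 := fun i ↦ by
    rw [← map_mul, mul_invOfUnit _ 1 (by simpa using h₁ i), map_one]
  have i₂ : ∀ i, map φ (e₂ i) * map φ ((e₂ i).invOfUnit 1) = 1 := fun i ↦ by
    rw [← map_mul, mul_invOfUnit _ 1 (by simpa using h₂ i), map_one]
  have hcont := continuous_map_of_discrete φ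
  -- Splits off a correction factor that becomes `1` under `φ` outside `T`, so the quotient of the
  -- products is a finite product.
  have hmap : ∀ i, map φ ((e₁ i).invOfUnit 1) =
      map φ ((e₂ i).invOfUnit 1) * map φ (e₂ i * (e₁ i).invOfUnit 1) := fun i ↦ by
    rw [map_mul]
    linear_combination -(map φ ((e₁ i).invOfUnit 1)) * i₂ i
  have hsupp : (Function.mulSupport fun i ↦ map φ (e₂ i * (e₁ i).invOfUnit 1)) ⊆ T := fun i hi ↦ by
    by_contra hiT
    refine hi ?_
    beta_reduce
    rw [map_mul, ← heq i hiT, i₁]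
  have hL : map φ (∏' i, (e₁ i).invOfUnit 1) = map φ (∏' i, (e₂ i).invOfUnit 1) *
      map φ (∏ᶠ i ∈ T, e₂ i * (e₁ i).invOfUnit 1) := by
    rw [m₁.map_tprod (map φ) hcont, m₂.map_tprod (map φ) hcont]
    simp_rw [hmap]
    rw [Multipliable.tprod_mul (f := fun i ↦ map φ ((e₂ i).invOfUnit 1)) (m₂.map (map φ) hcont)
      (multipliable_of_hasFiniteMulSupport (hT.subset hsupp)),
      tprod_eq_finprod (hT.subset hsupp), finprod_mem_eq_finite_toFinset_prod _ hT, map_prod,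
      finprod_eq_prod_of_mulSupport_subset _ (s := hT.toFinset) (by simpa using hsupp)]
  have hinv : map φ (∏' i, (e₂ i).invOfUnit 1) *
      map φ ((∏' i, (e₂ i).invOfUnit 1).invOfUnit 1) = 1 := by
    rw [← map_mul, mul_invOfUnit _ 1 (by simpa using hc₂), map_one]
  rw [map_mul, hL]
  linear_combination map φ (∏ᶠ i ∈ T, e₂ i * (e₁ i).invOfUnit 1) * hinv

end PowerSeries

/-! ### Parity of the number of points -/

namespace WeierstrassCurve

section PointCount

variable {F : Type*} [Field F]

/-- The roots of the `2`-torsion polynomial in the ground field. -/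
def twoTorsionRoots (W : WeierstrassCurve F) : Set F :=
  {x | 4 * x ^ 3 + W.b₂ * x ^ 2 + 2 * W.b₄ * x + W.b₆ = 0}

theorem negY_eq_self_iff_mem_twoTorsionRoots (W : WeierstrassCurve F) {x y : F}
    (h : W.toAffine.Equation x y) :
    W.toAffine.negY x y = y ↔ x ∈ W.twoTorsionRoots := by
  have key : (2 * y + W.a₁ * x + W.a₃) ^ 2 =
      4 * x ^ 3 + W.b₂ * x ^ 2 + 2 * W.b₄ * x + W.b₆ := by
    rw [Affine.equation_iff'] at h
    simp only [b₂, b₄, b₆]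
    linear_combination 4 * h
  rw [twoTorsionRoots, Set.mem_ofPred_eq, ← key, sq_eq_zero_iff, Affine.negY]
  constructor <;> intro h' <;> linear_combination -h'

theorem exists_equation_negY_eq_of_mem_twoTorsionRoots (h2 : (2 : F) ≠ 0) (W : WeierstrassCurve F)
    {x : F} (hx : x ∈ W.twoTorsionRoots) :
    W.toAffine.Equation x (-(W.a₁ * x + W.a₃) / 2) := by
  rw [twoTorsionRoots, Set.mem_ofPred_eq] at hx
  simp only [b₂, b₄, b₆] at hx
  rw [Affine.equation_iff']
  field_simp
  linear_combination -hx

/-- A set and the fixed points of an involution on it have cardinalities of the same parity.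
Negation fixes the point at infinity and, as `2` is invertible, exactly one point above each root of
the cubic. -/
theorem natCard_point_modEq (h2 : (2 : F) ≠ 0) [Finite F] (W : WeierstrassCurve F) [W.IsElliptic] :
    Nat.card W.toAffine.Point ≡ 1 + Nat.card W.twoTorsionRoots [MOD 2] := by
  classical
  have : Finite W.toAffine.Point := by
    refine Finite.of_injective (β := Option (F × F)) (fun P ↦ match P with
      | .zero => none
      | .some x y _ => some (x, y)) fun P Q h ↦ ?_
    cases P <;> cases Q <;> simp_all
  have := Fintype.ofFinite W.toAffine.Point
  have := Fintype.ofFinite W.twoTorsionRoots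
  let f : Function.End W.toAffine.Point := fun P ↦ -P
  have hf : f ^ 2 ^ 1 = 1 := by
    funext P
    exact neg_neg P
  have hmod := Equiv.Perm.card_fixedPoints_modEq (p := 2) (n := 1) hf
  let e : Option W.twoTorsionRoots → Function.fixedPoints f := fun o ↦ match o with
    | none => ⟨.zero, rfl⟩
    | some x => ⟨Affine.Point.mk (exists_equation_negY_eq_of_mem_twoTorsionRoots h2 W x.2), by
        have := (negY_eq_self_iff_mem_twoTorsionRoots W
          (exists_equation_negY_eq_of_mem_twoTorsionRoots h2 W x.2)).mpr x.2
        simp only [Function.mem_fixedPoints, Function.IsFixedPt, f, Affine.Point.mk,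
          Affine.Point.neg_some, this]⟩
  have he : Function.Bijective e := by
    constructor
    · rintro (_ | x) (_ | x') h
      · rfl
      · exact (Affine.Point.some_ne_zero _ (congrArg Subtype.val h).symm).elim
      · exact (Affine.Point.some_ne_zero _ (congrArg Subtype.val h)).elim
      · simp only [e, Affine.Point.mk, Subtype.mk.injEq, Affine.Point.some.injEq] at h
        rw [Subtype.ext h.1]
    · rintro ⟨P, hP⟩
      rcases P with _ | ⟨x, y, h⟩
      · exact ⟨none, rfl⟩
      · simp only [Function.mem_fixedPoints, Function.IsFixedPt, f, Affine.Point.neg_some,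
          Affine.Point.some.injEq, true_and] at hP
        refine ⟨some ⟨x, (negY_eq_self_iff_mem_twoTorsionRoots W h.1).mp hP⟩, ?_⟩
        simp only [e, Affine.Point.mk, Subtype.mk.injEq, Affine.Point.some.injEq, true_and]
        rw [Affine.negY] at hP
        field_simp
        linear_combination hP
  rw [← Fintype.card_of_bijective he, Fintype.card_option] at hmod
  rw [Nat.card_eq_fintype_card, Nat.card_eq_fintype_card, add_comm 1]
  exact hmod

end PointCount

/-! ### Quadratic twists through their `b`-invariants -/

/-- The `b`-invariants of `W'` arise from those of `W` by scaling by `w` and translating by `r`: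
over a field in which `2` is invertible, `W'` is a quadratic twist of `W`. -/
structure IsTwist {R : Type*} [CommRing R] (W W' : WeierstrassCurve R) (w r : R) : Prop where
  b₂_eq : w * W'.b₂ = W.b₂ + 12 * r
  b₄_eq : w ^ 2 * W'.b₄ = W.b₄ + r * W.b₂ + 6 * r ^ 2
  b₆_eq : w ^ 3 * W'.b₆ = W.b₆ + 2 * r * W.b₄ + r ^ 2 * W.b₂ + 4 * r ^ 3

namespace IsTwist

section CommRing

variable {R : Type*} [CommRing R] {W W' W'' : WeierstrassCurve R} {w r w' r' : R}

theorem trans (h : IsTwist W W' w r) (h' : IsTwist W' W'' w' r') :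
    IsTwist W W'' (w * w') (r + w * r') where
  b₂_eq := by linear_combination w * h'.b₂_eq + h.b₂_eq
  b₄_eq := by linear_combination w ^ 2 * h'.b₄_eq + h.b₄_eq + r' * w * h.b₂_eq
  b₆_eq := by
    linear_combination w ^ 3 * h'.b₆_eq + h.b₆_eq + 2 * r' * w * h.b₄_eq +
      r' ^ 2 * w ^ 2 * h.b₂_eq

theorem map {S : Type*} [CommRing S] (φ : R →+* S) (h : IsTwist W W' w r) :
    IsTwist (W.map φ) (W'.map φ) (φ w) (φ r) where
  b₂_eq := by simpa [map_ofNat] using congrArg φ h.b₂_eq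
  b₄_eq := by simpa [map_ofNat] using congrArg φ h.b₄_eq
  b₆_eq := by simpa [map_ofNat] using congrArg φ h.b₆_eq

theorem of_map {S : Type*} [CommRing S] {φ : R →+* S} (hφ : Function.Injective φ)
    (h : IsTwist (W.map φ) (W'.map φ) (φ w) (φ r)) : IsTwist W W' w r where
  b₂_eq := hφ (by simpa [map_ofNat] using h.b₂_eq)
  b₄_eq := hφ (by simpa [map_ofNat] using h.b₄_eq)
  b₆_eq := hφ (by simpa [map_ofNat] using h.b₆_eq)

theorem smul (W : WeierstrassCurve R) (C : VariableChange R) :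
    IsTwist W (C • W) (C.u ^ 2) C.r := by
  have hu : (C.u : R) * (C.u⁻¹ : Rˣ) = 1 := C.u.mul_inv
  have h (n : ℕ) (a : R) : (C.u : R) ^ n * ((C.u⁻¹ : Rˣ) ^ n * a) = a := by
    rw [← mul_assoc, ← mul_pow, hu, one_pow, one_mul]
  constructor
  · rw [variableChange_b₂, h]
  · rw [variableChange_b₄, ← pow_mul, h]
  · rw [variableChange_b₆, ← pow_mul, h]

/-- The factor `4` removes `b₈`: by `b_relation`, `4 * Δ` is a polynomial in `b₂`, `b₄`, `b₆`. It is
invariant under translation and scales with weight `6` in `w`. -/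
theorem four_mul_Δ (h : IsTwist W W' w r) : 4 * (w ^ 6 * W'.Δ) = 4 * W.Δ := by
  have h4 (V : WeierstrassCurve R) : 4 * V.Δ =
      -V.b₂ ^ 2 * (V.b₂ * V.b₆ - V.b₄ ^ 2) - 32 * V.b₄ ^ 3 - 108 * V.b₆ ^ 2 +
        36 * V.b₂ * V.b₄ * V.b₆ := by
    rw [Δ]
    linear_combination -V.b₂ ^ 2 * V.b_relation
  have h6 : 4 * (w ^ 6 * W'.Δ) =
      -(w * W'.b₂) ^ 2 * ((w * W'.b₂) * (w ^ 3 * W'.b₆) - (w ^ 2 * W'.b₄) ^ 2) -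
        32 * (w ^ 2 * W'.b₄) ^ 3 - 108 * (w ^ 3 * W'.b₆) ^ 2 +
        36 * (w * W'.b₂) * (w ^ 2 * W'.b₄) * (w ^ 3 * W'.b₆) := by
    linear_combination w ^ 6 * h4 W'
  rw [h6, h.b₂_eq, h.b₄_eq, h.b₆_eq, h4]
  ring

end CommRing

section Field

variable {F : Type*} [Field F] {W W' : WeierstrassCurve F} {w r : F}

theorem symm (h : IsTwist W W' w r) (hw : w ≠ 0) : IsTwist W' W w⁻¹ (-r / w) where
  b₂_eq := by
    field_simp
    linear_combination -h.b₂_eq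
  b₄_eq := by
    field_simp
    linear_combination -h.b₄_eq + r * h.b₂_eq
  b₆_eq := by
    field_simp
    linear_combination -h.b₆_eq + 2 * r * h.b₄_eq - r ^ 2 * h.b₂_eq

/-- The map `x ↦ w * x + r` carries the roots for `W'` to those for `W`, since it pulls the cubic of
`W` back to `w ^ 3` times the cubic of `W'`. -/
theorem natCard_twoTorsionRoots (h : IsTwist W W' w r) (hw : w ≠ 0) :
    Nat.card W'.twoTorsionRoots = Nat.card W.twoTorsionRoots := by
  refine Nat.card_congr (((Equiv.mulLeft₀ w hw).trans (Equiv.addRight r)).subtypeEquiv fun x ↦ ?_)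
  simp only [twoTorsionRoots, Set.mem_ofPred_eq, Equiv.trans_apply, Equiv.mulLeft₀_apply,
    Equiv.coe_addRight]
  rw [← mul_eq_zero_iff_left (pow_ne_zero 3 hw)]
  refine Eq.congr_left ?_
  linear_combination w ^ 2 * x ^ 2 * h.b₂_eq + 2 * w * x * h.b₄_eq + h.b₆_eq

theorem quadraticTwist (h2 : (2 : F) ≠ 0) (W : WeierstrassCurve F) (f : Fˣ) :
    IsTwist W (W.quadraticTwist f) (f⁻¹ : Fˣ) 0 := by
  have hf : (f : F) ≠ 0 := f.ne_zero
  have h4 : (4 : F) ≠ 0 := by rw [show (4 : F) = 2 ^ 2 by norm_num]; exact pow_ne_zero _ h2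
  have e2 : (W.quadraticTwist f).b₂ = f * W.b₂ := by
    simp only [b₂, WeierstrassCurve.quadraticTwist]; field_simp; ring
  have e4 : (W.quadraticTwist f).b₄ = f ^ 2 * W.b₄ := by
    simp only [b₄, WeierstrassCurve.quadraticTwist]; field_simp; ring
  have e6 : (W.quadraticTwist f).b₆ = f ^ 3 * W.b₆ := by
    simp only [b₆, WeierstrassCurve.quadraticTwist]; field_simp; ring
  constructor
  · rw [e2, Units.val_inv_eq_inv_val]; field_simp; ring
  · rw [e4, Units.val_inv_eq_inv_val]; field_simp; ring
  · rw [e6, Units.val_inv_eq_inv_val]; field_simp; ring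

end Field

/-- A twist between two curves over an integrally closed domain with unit discriminants is defined
over that domain. -/
theorem exists_isUnit_of_baseChange {R K : Type*} [CommRing R] [IsDomain R] [IsIntegrallyClosed R]
    [Field K] [Algebra R K] [IsFractionRing R K] (h2 : IsUnit (2 : R)) (h3 : IsUnit (3 : R))
    {W W' : WeierstrassCurve R} (hW : IsUnit W.Δ) (hW' : IsUnit W'.Δ) {w r : K}
    (h : IsTwist (W.map (algebraMap R K)) (W'.map (algebraMap R K)) w r) :
    ∃ w₀ r₀ : R, IsUnit w₀ ∧ IsTwist W W' w₀ r₀ := by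
  have hinj := IsFractionRing.injective R K
  have h2K : (2 : K) ≠ 0 := by
    have := (h2.map (algebraMap R K)).ne_zero
    rwa [map_ofNat] at this
  have h4K : (4 : K) ≠ 0 := by
    rw [show (4 : K) = 2 ^ 2 by norm_num]; exact pow_ne_zero _ h2K
  have hΔ : w ^ 6 * algebraMap R K W'.Δ = algebraMap R K W.Δ := by
    simpa using mul_left_cancel₀ h4K h.four_mul_Δ
  obtain ⟨d, hd⟩ := hW'.exists_right_inv
  -- `w ^ 6` is a quotient of unit discriminants, so integral closedness puts `w` in `R`, where it
  -- is a unit.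
  have hw6 : w ^ 6 = algebraMap R K (W.Δ * d) := by
    rw [map_mul, ← hΔ, mul_assoc, ← map_mul, hd, map_one, mul_one]
  obtain ⟨w₀, rfl⟩ := IsIntegrallyClosed.exists_algebraMap_eq_of_isIntegral_pow (R := R) (x := w)
    (n := 6) (by norm_num) (hw6 ▸ isIntegral_algebraMap)
  have hw₀ : IsUnit w₀ := by
    rw [← map_pow] at hw6
    have := hinj hw6
    refine (isUnit_pow_iff (n := 6) (by norm_num)).mp (this ▸ hW.mul ?_)
    exact IsUnit.of_mul_eq_one W'.Δ (by rw [mul_comm]; exact hd)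
  obtain ⟨c, hc⟩ : ∃ c : R, 12 * c = 1 :=
    (show IsUnit (12 : R) by
      rw [show (12 : R) = 2 ^ 2 * 3 by norm_num]; exact (h2.pow 2).mul h3).exists_right_inv
  -- The `b₂` relation is linear in `r` with coefficient `12`, which is invertible.
  have hr : r = algebraMap R K (c * (w₀ * W'.b₂ - W.b₂)) := by
    have h1 := h.b₂_eq
    have hc' : 12 * algebraMap R K c = 1 := by
      simpa [map_ofNat] using congrArg (algebraMap R K) hc
    simp only [map_b₂] at h1
    simp only [map_mul, map_sub]
    linear_combination (-algebraMap R K c) * h1 - r * hc'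
  rw [hr] at h
  exact ⟨w₀, _, hw₀, h.of_map hinj⟩

end IsTwist

/-! ### Good reduction over a discrete valuation ring -/

section Reduction

open IsLocalRing

variable {R : Type*} [CommRing R] [IsDomain R] [IsDiscreteValuationRing R]
  {K : Type*} [Field K] [Algebra R K] [IsFractionRing R K]

/-- Twists with good reduction have point counts of the same parity. -/
theorem natCard_reduction_modEq [Finite (ResidueField R)] (h2 : IsUnit (2 : R))
    (h3 : IsUnit (3 : R)) {W W' : WeierstrassCurve K} [IsMinimal R W] [IsMinimal R W']
    (hW : W.HasGoodReduction R) (hW' : W'.HasGoodReduction R) {w r : K} (h : IsTwist W W' w r) :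
    Nat.card (W.reduction R).toAffine.Point ≡ Nat.card (W'.reduction R).toAffine.Point [MOD 2] := by
  have e := (hasGoodReduction_iff_isElliptic_reduction R).mp hW
  have e' := (hasGoodReduction_iff_isElliptic_reduction R).mp hW'
  have unit_Δ (V : WeierstrassCurve K) [IsMinimal R V] (hV : (V.reduction R).IsElliptic) :
      IsUnit (V.integralModel R).Δ := by
    rw [isElliptic_iff, reduction, map_Δ] at hV
    exact isUnit_of_map_unit (residue R) _ hV
  rw [← baseChange_integralModel_eq R W, ← baseChange_integralModel_eq R W'] at h
  obtain ⟨w₀, r₀, hw₀, h₀⟩ :=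
    IsTwist.exists_isUnit_of_baseChange h2 h3 (unit_Δ W e) (unit_Δ W' e') h
  have h2' : (2 : ResidueField R) ≠ 0 := by
    have := (h2.map (residue R)).ne_zero
    rwa [map_ofNat] at this
  have hcard := (h₀.map (residue R)).natCard_twoTorsionRoots (hw₀.map (residue R)).ne_zero
  refine (natCard_point_modEq h2' (W.reduction R)).trans ?_
  rw [reduction, ← hcard]
  exact (natCard_point_modEq h2' (W'.reduction R)).symm

/-- A minimal model maximises the multiplicative valuation of the discriminant among integral
models. The given model already attains the upper bound `1`, so the minimal one does too. -/
theorem hasGoodReduction_minimal_of_isUnit_Δ {I : WeierstrassCurve R} (hI : IsUnit I.Δ) :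
    ((I.map (algebraMap R K)).minimal R).HasGoodReduction R := by
  set W := I.map (algebraMap R K) with hW
  have hint : IsIntegral R W := ⟨I, rfl⟩
  obtain ⟨C, hC⟩ : ∃ C : VariableChange K, W.minimal R = C • W := ⟨_, rfl⟩
  have hmin : IsMinimal R (W.minimal R) := inferInstance
  have hWC : C⁻¹ • W.minimal R = W := by rw [hC, inv_smul_smul]
  have hone : ((valuation_Δ_aux R W : _) : WithZero (Multiplicative ℤ)) = 1 := by
    rw [valuation_Δ_aux_eq_of_isIntegral, hW, map_Δ]
    refine le_antisymm (IsDedekindDomain.HeightOneSpectrum.valuation_le_one _ _) ?_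
    refine not_lt.mp fun hlt ↦ ?_
    rw [IsDedekindDomain.HeightOneSpectrum.valuation_lt_one_iff_mem] at hlt
    exact (mem_maximalIdeal _).mp hlt hI
  have hle := hmin.val_Δ_maximal.2 (j := C⁻¹) (by beta_reduce; rw [hWC]; exact hint) (by
    simp only [hWC]
    rw [← Subtype.coe_le_coe, hone]
    exact (valuation_Δ_aux R _).2)
  simp only [hWC, one_smul] at hle
  rw [← Subtype.coe_le_coe, hone, valuation_Δ_aux_eq_of_isIntegral] at hle
  refine ⟨le_antisymm ?_ hle⟩
  rw [← valuation_Δ_aux_eq_of_isIntegral]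
  exact (valuation_Δ_aux R _).2

end Reduction

end WeierstrassCurve

/-! ### Euler factors and the `L`-series -/

namespace WeierstrassCurve

theorem localPolynomial_coeff_zero (R : Type*) [CommRing R] [IsDomain R]
    [IsDiscreteValuationRing R] {K : Type*} [Field K] [Algebra R K] [IsFractionRing R K]
    (W : WeierstrassCurve K) : (W.localPolynomial R).coeff 0 = 1 := by
  unfold localPolynomial
  split_ifs <;> simp

section Places

variable {k K : Type*} [Field k] [Field K] [Algebra k K]

theorem X_pow_degree_dvd_eulerFactor_sub_one (W : WeierstrassCurve K) (v : Place k K) :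
    (PowerSeries.X : ℤ⟦X⟧) ^ v.degree ∣ W.eulerFactor v - 1 := by
  obtain ⟨g, hg⟩ : (Polynomial.X : ℤ[X]) ∣ W.localPolynomial v.ring - 1 := by
    rw [Polynomial.X_dvd_iff, Polynomial.coeff_sub, localPolynomial_coeff_zero]
    simp
  refine ⟨(Polynomial.expand ℤ v.degree g : ℤ[X]), ?_⟩
  have h := congrArg (Polynomial.expand ℤ v.degree) hg
  rw [map_sub, map_one, map_mul, Polynomial.expand_X] at h
  have h' := congrArg (fun q : ℤ[X] ↦ (q : ℤ⟦X⟧)) h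
  simpa [eulerFactor] using h'

theorem constantCoeff_eulerFactor (hK : IsCurveFunctionField k K) (W : WeierstrassCurve K)
    (v : Place k K) : PowerSeries.constantCoeff (W.eulerFactor v) = 1 := by
  have h := PowerSeries.X_pow_dvd_iff.mp (W.X_pow_degree_dvd_eulerFactor_sub_one v) 0
    (v.degree_pos hK)
  rw [PowerSeries.coeff_zero_eq_constantCoeff, map_sub, map_one] at h
  exact sub_eq_zero.mp h

theorem degree_le_order_invOfUnit_eulerFactor_sub_one (hK : IsCurveFunctionField k K)
    (W : WeierstrassCurve K) (v : Place k K) :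
    (v.degree : ℕ∞) ≤ ((W.eulerFactor v).invOfUnit 1 - 1).order := by
  have h1 : W.eulerFactor v * (W.eulerFactor v).invOfUnit 1 = 1 :=
    PowerSeries.mul_invOfUnit _ 1 (by simpa using W.constantCoeff_eulerFactor hK v)
  have h2 : (W.eulerFactor v).invOfUnit 1 - 1 =
      (W.eulerFactor v - 1) * -(W.eulerFactor v).invOfUnit 1 := by
    linear_combination h1
  have h3 : PowerSeries.X ^ v.degree ∣ (W.eulerFactor v).invOfUnit 1 - 1 :=
    h2 ▸ (W.X_pow_degree_dvd_eulerFactor_sub_one v).mul_right _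
  refine PowerSeries.le_order _ _ fun i hi ↦ ?_
  exact PowerSeries.X_pow_dvd_iff.mp h3 i (by exact_mod_cast hi)

theorem multipliable_invOfUnit_eulerFactor [Finite k] (hK : IsCurveFunctionField k K)
    (W : WeierstrassCurve K) :
    Multipliable fun v : Place k K ↦ (W.eulerFactor v).invOfUnit 1 := by
  have h := PowerSeries.multipliable_one_add_of_finite_order_le
    (f := fun v : Place k K ↦ (W.eulerFactor v).invOfUnit 1 - 1) fun n ↦
      (Place.finite_setOf_degree_le hK n).subset fun v hv ↦ by
        exact_mod_cast (W.degree_le_order_invOfUnit_eulerFactor_sub_one hK v).trans hv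
  simpa using h

theorem constantCoeff_LSeriesOverCurve [Finite k] (hK : IsCurveFunctionField k K)
    (W : WeierstrassCurve K) : PowerSeries.constantCoeff (W.LSeriesOverCurve k) = 1 :=
  PowerSeries.constantCoeff_tprod_eq_one (W.multipliable_invOfUnit_eulerFactor hK) fun v ↦ by
    simp [PowerSeries.constantCoeff_invOfUnit]

/-- Away from the poles of the coefficients and the zeros and poles of `Δ`, the given equation is
itself integral with unit discriminant. -/
theorem finite_compl_goodPlaces (hK : IsCurveFunctionField k K) (W : WeierstrassCurve K)
    (hΔ : W.Δ ≠ 0) : (W.goodPlaces k)ᶜ.Finite := by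
  have hfin (a : K) : {v : Place k K | a ∉ v.ring}.Finite := by
    by_cases ha : a = 0
    · exact Set.finite_empty.subset fun v hv ↦ hv (ha ▸ v.ring.zero_mem)
    · refine (Place.finite_setOf_valuation_ne_one hK ha).subset fun v hv h ↦ hv ?_
      exact (v.ring.valuation_le_one_iff _).mp (le_of_eq h)
  refine ((hfin W.a₁).union <| (hfin W.a₂).union <| (hfin W.a₃).union <| (hfin W.a₄).union <|
    (hfin W.a₆).union <| Place.finite_setOf_valuation_ne_one hK hΔ).subset fun v hv ↦ ?_
  by_contra hcon
  simp only [Set.mem_union, Set.mem_ofPred_eq, not_or, not_not] at hcon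
  obtain ⟨h₁, h₂, h₃, h₄, h₆, h⟩ := hcon
  let I : WeierstrassCurve v.ring := ⟨⟨_, h₁⟩, ⟨_, h₂⟩, ⟨_, h₃⟩, ⟨_, h₄⟩, ⟨_, h₆⟩⟩
  have hI : I.map (algebraMap v.ring K) = W := rfl
  refine hv ?_
  rw [goodPlaces, Set.mem_ofPred_eq, ← hI]
  refine hasGoodReduction_minimal_of_isUnit_Δ ((v.ring.valuation_eq_one_iff _).mpr ?_)
  rw [← h, ← hI, map_Δ]
  rfl

theorem Δ_quadraticTwist_ne_zero (h2 : (2 : K) ≠ 0) (W : WeierstrassCurve K) (hΔ : W.Δ ≠ 0)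
    (f : Kˣ) : (W.quadraticTwist f).Δ ≠ 0 := by
  intro h
  have h4 : (4 : K) ≠ 0 := by rw [show (4 : K) = 2 ^ 2 by norm_num]; exact pow_ne_zero _ h2
  have := (IsTwist.quadraticTwist h2 W f).four_mul_Δ
  rw [h, mul_zero, mul_zero] at this
  exact (mul_ne_zero h4 hΔ) this.symm

/-- Both minimal models are twists of `W`: a change of variables is a twist whose scale is a square,
and twists compose and invert. -/
theorem isTwist_minimal_quadraticTwist (h2 : (2 : K) ≠ 0) (W : WeierstrassCurve K) (f₁ f₂ : Kˣ)
    (v : Place k K) :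
    ∃ w r : K, IsTwist ((W.quadraticTwist f₁).minimal v.ring)
      ((W.quadraticTwist f₂).minimal v.ring) w r := by
  have h (f : Kˣ) : ∃ w r : K, w ≠ 0 ∧ IsTwist W ((W.quadraticTwist f).minimal v.ring) w r :=
    ⟨_, _, mul_ne_zero f⁻¹.ne_zero (pow_ne_zero 2 (Units.ne_zero _)),
      (IsTwist.quadraticTwist h2 W f).trans (IsTwist.smul _ _)⟩
  obtain ⟨w₁, r₁, hw₁, h₁⟩ := h f₁
  obtain ⟨w₂, r₂, -, h₂⟩ := h f₂
  exact ⟨_, _, (h₁.symm hw₁).trans h₂⟩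

theorem isUnit_natCast_placeRing (v : Place k K) {n : ℕ} (hn : (n : k) ≠ 0) :
    IsUnit (n : v.ring) := by
  rw [v.ring.valuation_eq_one_iff]
  simpa using v.valuation_algebraMap hn

/-- At a place where two twists of a curve have the same type of reduction, their Euler factors
agree modulo `2`. -/
theorem map_eulerFactor_quadraticTwist_eq [Finite k] (h2 : (2 : k) ≠ 0) (h3 : (3 : k) ≠ 0)
    (hK : IsCurveFunctionField k K) (W : WeierstrassCurve K) (f₁ f₂ : Kˣ) {v : Place k K}
    (hv : v ∈ W.sameReductionPlaces k f₁ f₂) :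
    PowerSeries.map (Int.castRingHom (ZMod 2)) ((W.quadraticTwist f₁).eulerFactor v) =
      PowerSeries.map (Int.castRingHom (ZMod 2)) ((W.quadraticTwist f₂).eulerFactor v) := by
  suffices h : ((W.quadraticTwist f₁).localPolynomial v.ring).map (Int.castRingHom (ZMod 2)) =
      ((W.quadraticTwist f₂).localPolynomial v.ring).map (Int.castRingHom (ZMod 2)) by
    simp only [eulerFactor, ← Polynomial.polynomial_map_coe, Polynomial.map_expand, h]
  have h2K : (2 : K) ≠ 0 := by
    simpa [map_ofNat] using (map_ne_zero (algebraMap k K)).mpr h2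
  have hneg : (-1 : (ZMod 2)[X]) = 1 := by
    rw [← Polynomial.C_1, ← Polynomial.C_neg]
    rfl
  have hmult (V : WeierstrassCurve K) (hV : (V.minimal v.ring).HasMultiplicativeReduction v.ring) :
      (V.localPolynomial v.ring).map (Int.castRingHom (ZMod 2)) = 1 + Polynomial.X := by
    unfold localPolynomial
    simp only [if_neg hV.not_hasGoodReduction, if_pos hV]
    split_ifs
    · simp only [Polynomial.map_sub, Polynomial.map_one, Polynomial.map_X]
      linear_combination Polynomial.X * hneg
    · simp
  have hadd (V : WeierstrassCurve K) (hV : (V.minimal v.ring).HasAdditiveReduction v.ring) :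
      V.localPolynomial v.ring = 1 := by
    unfold localPolynomial
    have hs : ¬ (V.minimal v.ring).HasSplitMultiplicativeReduction v.ring :=
      fun h ↦ hV.not_hasMultiplicativeReduction _ h.toHasMultiplicativeReduction
    rw [if_neg hV.not_hasGoodReduction, if_neg hs, if_neg hV.not_hasMultiplicativeReduction]
  rcases hv with (⟨g₁, g₂⟩ | ⟨m₁, m₂⟩) | ⟨a₁, a₂⟩
  · have := v.finite_residueField_of_finite hK
    rw [goodPlaces, Set.mem_ofPred_eq] at g₁ g₂
    obtain ⟨w, r, h⟩ := isTwist_minimal_quadraticTwist h2K W f₁ f₂ v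
    have hmod := natCard_reduction_modEq
      (by simpa using isUnit_natCast_placeRing v (n := 2) (by simpa using h2))
      (by simpa using isUnit_natCast_placeRing v (n := 3) (by simpa using h3)) g₁ g₂ h
    have hmod' := (ZMod.natCast_eq_natCast_iff _ _ _).mpr hmod
    unfold localPolynomial
    rw [if_pos g₁, if_pos g₂]
    -- The constant and quadratic coefficients depend only on `v`; the linear one involves the curve
    -- only through its point count.
    simpa using congrArg Polynomial.C hmod'
  · rw [hmult _ m₁, hmult _ m₂]
  · rw [hadd _ a₁, hadd _ a₂]

end Places

end WeierstrassCurve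

/-- The first three clauses say that the Euler products, the quotient of the two `L`-functions in
`1 + T ℤ⟦T⟧` and the product over the places outside `U_{f₁,f₂}` make sense. -/
theorem theorem3p10 (k K : Type*) [Field k] [Finite k] [Field K] [Algebra k K]
    (p : ℕ) [CharP k p] (hp : 5 ≤ p) (hK : IsCurveFunctionField k K)
    (E : WeierstrassCurve K) [E.IsElliptic] (hj : E.j ∉ (algebraMap k K).range)
    (f₁ f₂ : Kˣ) :
    (∀ f : Kˣ,
      Multipliable (fun v : Place k K => ((E.quadraticTwist f).eulerFactor v).invOfUnit 1)) ∧
    (∀ f : Kˣ,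
      PowerSeries.constantCoeff ((E.quadraticTwist f).LSeriesOverCurve k) = 1 ∧
      ∀ v : Place k K, PowerSeries.constantCoeff ((E.quadraticTwist f).eulerFactor v) = 1) ∧
    (E.sameReductionPlaces k f₁ f₂)ᶜ.Finite ∧
    PowerSeries.map (Int.castRingHom (ZMod 2))
        ((E.quadraticTwist f₁).LSeriesOverCurve k *
          ((E.quadraticTwist f₂).LSeriesOverCurve k).invOfUnit 1) =
      PowerSeries.map (Int.castRingHom (ZMod 2))
        (∏ᶠ v ∈ (E.sameReductionPlaces k f₁ f₂)ᶜ,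
          (E.quadraticTwist f₂).eulerFactor v *
            ((E.quadraticTwist f₁).eulerFactor v).invOfUnit 1) := by
  have hcast (n : ℕ) (h0 : 0 < n) (hn : n < 5) : (n : k) ≠ 0 := fun h ↦ by
    have := Nat.le_of_dvd h0 ((CharP.cast_eq_zero_iff k p n).mp h)
    omega
  have h2 : (2 : k) ≠ 0 := by exact_mod_cast hcast 2 (by norm_num) (by norm_num)
  have h3 : (3 : k) ≠ 0 := by exact_mod_cast hcast 3 (by norm_num) (by norm_num)
  have h2K : (2 : K) ≠ 0 := by
    simpa [map_ofNat] using (map_ne_zero (algebraMap k K)).mpr h2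
  have hfin : (E.sameReductionPlaces k f₁ f₂)ᶜ.Finite := by
    have h (f : Kˣ) := (E.quadraticTwist f).finite_compl_goodPlaces hK
      (E.Δ_quadraticTwist_ne_zero h2K E.isUnit_Δ.ne_zero f)
    refine ((h f₁).union (h f₂)).subset ?_
    rw [← Set.compl_inter]
    exact Set.compl_subset_compl.mpr fun v hv ↦ .inl (.inl hv)
  refine ⟨fun f ↦ (E.quadraticTwist f).multipliable_invOfUnit_eulerFactor hK,
    fun f ↦ ⟨(E.quadraticTwist f).constantCoeff_LSeriesOverCurve hK,
      (E.quadraticTwist f).constantCoeff_eulerFactor hK⟩, hfin, ?_⟩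
  exact PowerSeries.map_tprod_mul_invOfUnit _ ((E.quadraticTwist f₁).constantCoeff_eulerFactor hK)
    ((E.quadraticTwist f₂).constantCoeff_eulerFactor hK)
    ((E.quadraticTwist f₁).multipliable_invOfUnit_eulerFactor hK)
    ((E.quadraticTwist f₂).multipliable_invOfUnit_eulerFactor hK)
    ((E.quadraticTwist f₂).constantCoeff_LSeriesOverCurve hK) hfin fun v hv ↦
      E.map_eulerFactor_quadraticTwist_eq h2 h3 hK f₁ f₂ (not_not.mp hv)
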